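/- There is an absolute constant $C>0$ such that the following holds. Let $\mathcal X$ be a measurable space, let $\mathbb P$ be a probability distribution on $\mathcal X\times\{0,1\}$, let $\eta(x)=\mathbb P(y=1\mid x)\in[0,1]$ be the posterior probability (clean soft label), and let $$\mathrm{Err}^*=\inf_h \mathbb P\bigl(y\ne h(x)\bigr)$$ be the Bayes error, the infimum being over all measurable $h:\mathcal X\to\{0,1\}$. Let $n\ge 1$ and let $(x_1,y_1),\dots,(x_n,y_n)$ be i.i.d. with law $\mathbb P$, so that each instance $x_i$ comes with a single hard label $y_i$ drawn from the posterior given $x_i$; put $\eta_i=\eta(x_i)$. Suppose that there is a strictly increasing function $f:[0,1]\to\mathbb R$ such that the corrupted soft labels $\tilde\eta_1,\dots,\tilde\eta_n$ satisfy $\tilde\eta_i=f(\eta_i)$ almost surely for each $i$. Reorder $(\tilde\eta_1,y_1),\dots,(\tilde\eta_n,y_n)$ into $(\tilde\eta_{(1)},y_{(1)}),\dots,(\tilde\eta_{(n)},y_{(n)})$ with $\tilde\eta_{(1)}\le\dots\le\tilde\eta_{(n)}$, where the permutation is chosen by any fixed measurable rule that depends on $(\tilde\eta_1,\dots,\tilde\eta_n)$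 only (so ties are not broken by means of the hard labels). Let $\widehat\eta^{\mathrm{iso}}_{(1)}\le\dots\le\widehat\eta^{\mathrm{iso}}_{(n)}$ be the unique non-decreasing sequence in $[0,1]$ that minimizes $\frac1n\sum_{i=1}^n\bigl(y_{(i)}-\widehat\eta^{\mathrm{iso}}_{(i)}\bigr)^2$ over all such sequences, and let $$\widehat{\mathrm{Err}}=\frac1n\sum_{i=1}^n\min\bigl\{\widehat\eta^{\mathrm{iso}}_{(i)},\,1-\widehat\eta^{\mathrm{iso}}_{(i)}\bigr\}.$$ Then for every $\delta\in(0,1)$, with probability at least $1-\delta$, $$\bigl|\widehat{\mathrm{Err}}-\mathrm{Err}^*\bigr|\le C\left(\frac1{n^{1/3}}+\sqrt{\frac{\log(1/\delta)}{n}}\right).$$ -/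

import Mathlib

open MeasureTheory ProbabilityTheory Set

namespace BayesErr

/-- Error rate `𝔼_{(x,y) ∼ D} 𝟙{y ≠ h x}` of a classifier `h`. -/
noncomputable def errorRate {X : Type*} [MeasurableSpace X] (D : Measure (X × Fin 2))
    (h : X → Fin 2) : ℝ :=
  D.real {z | z.2 ≠ h z.1}

/-- The Bayes error: the infimum of the error rate over all measurable classifiers. -/
noncomputable def bayesError {X : Type*} [MeasurableSpace X] (D : Measure (X × Fin 2)) : ℝ :=
  ⨅ h : {h : X → Fin 2 // Measurable h}, errorRate D h.1

/-- `η` is (a version of) the posterior probability `x ↦ D(y = 1 ∣ x)`, the clean soft label. -/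
structure IsPosterior {X : Type*} [MeasurableSpace X] (D : Measure (X × Fin 2))
    (η : X → ℝ) : Prop where
  measurable : Measurable η
  mem_Icc : ∀ x, η x ∈ Icc (0 : ℝ) 1
  ae_eq : (fun z : X × Fin 2 => η z.1) =ᵐ[D]
    D⟦{z : X × Fin 2 | z.2 = 1} | MeasurableSpace.comap Prod.fst inferInstance⟧

/-- The plug-in estimate `(1/n) ∑ min {q i, 1 - q i}` of the Bayes error from soft labels `q`. -/
noncomputable def bayesErrorEstimate {n : ℕ} (q : Fin n → ℝ) : ℝ :=
  (1 / (n : ℝ)) * ∑ i, min (q i) (1 - q i)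

/-- Non-decreasing sequences `0 ≤ u 0 ≤ ⋯ ≤ u (n-1) ≤ 1`. -/
def isotonicSet (n : ℕ) : Set (Fin n → ℝ) :=
  {u | Monotone u ∧ ∀ i, u i ∈ Icc (0 : ℝ) 1}

/-- The squared error `(1/n) ∑ (y i - u i)²`. -/
noncomputable def squaredError {n : ℕ} (y u : Fin n → ℝ) : ℝ :=
  (1 / (n : ℝ)) * ∑ i, (y i - u i) ^ 2

/-- `u` minimizes the squared error to `y` among the non-decreasing sequences in `[0,1]`. -/
def IsIsotonicFit {n : ℕ} (y u : Fin n → ℝ) : Prop :=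
  u ∈ isotonicSet n ∧ ∀ v ∈ isotonicSet n, squaredError y u ≤ squaredError y v

theorem existsUnique_isIsotonicFit {n : ℕ} (y : Fin n → ℝ) : ∃! u, IsIsotonicFit y u := by
  have hcl : IsClosed (isotonicSet n) := by
    have h : isotonicSet n = (⋂ (i : Fin n) (j : Fin n) (_ : i ≤ j), {u | u i ≤ u j}) ∩
        ⋂ i : Fin n, {u | u i ∈ Icc (0 : ℝ) 1} := by
      ext u
      simp only [isotonicSet, Monotone, mem_ofPred_eq, mem_inter_iff, mem_iInter]
    rw [h]
    refine IsClosed.inter ?_ ?_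
    · exact isClosed_iInter fun i => isClosed_iInter fun j => isClosed_iInter fun _ =>
        isClosed_le (continuous_apply i) (continuous_apply j)
    · exact isClosed_iInter fun i => isClosed_Icc.preimage (continuous_apply i)
  have hcpt : IsCompact (isotonicSet n) :=
    (isCompact_univ_pi fun _ : Fin n => isCompact_Icc (a := (0 : ℝ)) (b := 1)).of_isClosed_subset
      hcl fun u hu i _ => hu.2 i
  have hne : (isotonicSet n).Nonempty :=
    ⟨fun _ => 0, monotone_const, fun _ => ⟨le_refl _, zero_le_one⟩⟩
  have hcont : Continuous (squaredError y) := by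
    unfold squaredError
    fun_prop
  obtain ⟨u, hu, hmin⟩ := hcpt.exists_isMinOn hne hcont.continuousOn
  refine ⟨u, ⟨hu, fun v hv => hmin hv⟩, ?_⟩
  rintro w ⟨hw, hwmin⟩
  rcases Nat.eq_zero_or_pos n with rfl | hn
  · exact Subsingleton.elim _ _
  have hm : (fun i => (u i + w i) / 2) ∈ isotonicSet n := by
    refine ⟨fun i j hij => ?_, fun i => ?_⟩
    · have h1 := hu.1 hij
      have h2 := hw.1 hij
      show (u i + w i) / 2 ≤ (u j + w j) / 2
      linarith
    · have h1 := hu.2 i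
      have h2 := hw.2 i
      exact ⟨by linarith [h1.1, h2.1], by linarith [h1.2, h2.2]⟩
  have a1 : squaredError y u ≤ squaredError y (fun i => (u i + w i) / 2) := hmin hm
  have a2 := hwmin _ hm
  have hn' : (0 : ℝ) < 1 / (n : ℝ) := by positivity
  unfold squaredError at a1 a2
  have b1 := le_of_mul_le_mul_left a1 hn'
  have b2 := le_of_mul_le_mul_left a2 hn'
  have key : ∑ i, (y i - (u i + w i) / 2) ^ 2 =
      (∑ i, (y i - u i) ^ 2 + ∑ i, (y i - w i) ^ 2) / 2 - (∑ i, (u i - w i) ^ 2) / 4 := by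
    rw [← Finset.sum_add_distrib, Finset.sum_div, Finset.sum_div, ← Finset.sum_sub_distrib]
    exact Finset.sum_congr rfl fun i _ => by ring
  have h0 : ∑ i, (u i - w i) ^ 2 ≤ 0 := by linarith
  have h1 := (Finset.sum_eq_zero_iff_of_nonneg fun i _ => sq_nonneg (u i - w i)).1
    (le_antisymm h0 (Finset.sum_nonneg fun i _ => sq_nonneg _))
  funext i
  have h2 := pow_eq_zero_iff (two_ne_zero) |>.1 (h1 i (Finset.mem_univ i))
  linarith

/-- The least squares fit to `y` by a non-decreasing sequence with values in `[0,1]`. -/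
noncomputable def isotonicFit {n : ℕ} (y : Fin n → ℝ) : Fin n → ℝ :=
  (existsUnique_isIsotonicFit y).choose

/-- A measurable rule `ρ` which, from the scores `c` alone, chooses a permutation `ρ c` that puts
them in non-decreasing order: `c (ρ c 0) ≤ c (ρ c 1) ≤ ⋯`. It fixes the order among tied scores. -/
structure IsSortingRule {n : ℕ} (ρ : (Fin n → ℝ) → Equiv.Perm (Fin n)) : Prop where
  monotone : ∀ c, Monotone (c ∘ ρ c)
  measurableSet : ∀ τ, MeasurableSet {c | ρ c = τ}

/-- Isotonic calibration of the scores `c` with labels `y`, the data being sorted by `ρ`: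
the `k`-th value of the fit to the sorted labels goes to the `k`-th instance in sorted order. -/
noncomputable def isotonicCalibration {n : ℕ} (ρ : (Fin n → ℝ) → Equiv.Perm (Fin n))
    (c y : Fin n → ℝ) : Fin n → ℝ :=
  fun i => isotonicFit (y ∘ ρ c) ((ρ c).symm i)

end BayesErr

/-!
Isotonic regression on sorted binary labels is empirical risk minimization over the `n + 1`
threshold classifiers "predict `0` on the first `k` instances and `1` on the rest". The plug-in loss
`∑ min {q i, 1 - q i}` of the fit `q` equals the smallest training error of such a classifier: first
order optimality of `q` along suitable tangent directions of the isotonic set shows that it is at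
most every such error (`IsIsotonicFit.sum_min_le`) and at least the error of the threshold where `q`
crosses `1/2` (`IsIsotonicFit.exists_thresholdLoss_le`). The scores put the true posteriors in
non-decreasing order, so `∑ min {η i, 1 - η i}` is likewise the smallest conditional risk of a
threshold classifier. The two differ by at most `max_k |∑ ± (y i - η i)|`, where the signs depend on
`k` and on the sorting permutation only (`IsIsotonicFit.abs_sum_min_sub_le`).

The labels can be realized as `y i = 1{u i < η i}` with uniform `u i` independent of the instances
(`IsPosterior.measurePreserving_pi_noise`). With the instances fixed, the permutation and the signs
are fixed, and Hoeffding's inequality bounds each signed sum. A union bound over `k` costs a factor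
`log n`, which the rate `n ^ (-1/3)` absorbs. Finally, the Bayes error is the mean of
`min {η, 1 - η}` (`IsPosterior.bayesError_eq`), and Hoeffding's inequality compares that mean with
the empirical one.
-/

namespace BayesErr

/-! ### Isotonic regression and threshold classifiers -/

/-- The total loss `∑_{i < k} q i + ∑_{i ≥ k} (1 - q i)` of the classifier that predicts `0` on the
first `k` sorted instances and `1` on the others. For 0/1 labels `q` this is the number of errors,
for posterior probabilities `q` the conditional expectation of that number. -/
noncomputable def thresholdLoss {n : ℕ} (q : Fin n → ℝ) (k : ℕ) : ℝ :=
  ∑ i : Fin n, if (i : ℕ) < k then q i else 1 - q i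

theorem isotonicFit_spec {n : ℕ} (y : Fin n → ℝ) : IsIsotonicFit y (isotonicFit y) :=
  (existsUnique_isIsotonicFit y).choose_spec.1

/-- Directions `d` in the tangent cone of the isotonic set at `q` stay in the set for a short time:
it suffices that `d` is non-decreasing on the level blocks of `q` and points inwards where `q`
attains the bounds `0` and `1`. -/
theorem eventually_add_mul_mem_isotonicSet {n : ℕ} {q d : Fin n → ℝ} (hq : q ∈ isotonicSet n)
    (hd : ∀ i j, i ≤ j → q i = q j → d i ≤ d j) (h0 : ∀ i, q i = 0 → 0 ≤ d i)
    (h1 : ∀ i, q i = 1 → d i ≤ 0) :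
    ∀ᶠ ε in nhdsWithin (0 : ℝ) (Ioi 0), (fun i => q i + ε * d i) ∈ isotonicSet n := by
  have key : ∀ a b a' b' : ℝ, a ≤ a' → (a = a' → b ≤ b') →
      ∀ᶠ ε in nhdsWithin (0 : ℝ) (Ioi 0), a + ε * b ≤ a' + ε * b' := by
    intro a b a' b' h h'
    rcases h.lt_or_eq with hlt | heq
    · have hl : Filter.Tendsto (fun ε : ℝ => a + ε * b) (nhds 0) (nhds a) := by
        have : Continuous fun ε : ℝ => a + ε * b := by fun_prop
        simpa using this.tendsto 0
      have hr : Filter.Tendsto (fun ε : ℝ => a' + ε * b') (nhds 0) (nhds a') := by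
        have : Continuous fun ε : ℝ => a' + ε * b' := by fun_prop
        simpa using this.tendsto 0
      exact ((hl.eventually_lt hr hlt).mono fun _ => le_of_lt).filter_mono nhdsWithin_le_nhds
    · filter_upwards [self_mem_nhdsWithin] with ε hε
      have := mul_le_mul_of_nonneg_left (h' heq) (le_of_lt hε)
      linarith
  have e1 : ∀ᶠ ε in nhdsWithin (0 : ℝ) (Ioi 0), ∀ i j : Fin n, i ≤ j →
      q i + ε * d i ≤ q j + ε * d j := by
    refine Filter.eventually_all.2 fun i => Filter.eventually_all.2 fun j => ?_
    by_cases hij : i ≤ j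
    · filter_upwards [key _ (d i) _ (d j) (hq.1 hij) (hd i j hij)] with ε h _ using h
    · exact Filter.Eventually.of_forall fun ε h => absurd h hij
  have e2 : ∀ᶠ ε in nhdsWithin (0 : ℝ) (Ioi 0), ∀ i : Fin n, 0 ≤ q i + ε * d i := by
    refine Filter.eventually_all.2 fun i => ?_
    simpa using key 0 0 (q i) (d i) (hq.2 i).1 fun h => h0 i h.symm
  have e3 : ∀ᶠ ε in nhdsWithin (0 : ℝ) (Ioi 0), ∀ i : Fin n, q i + ε * d i ≤ 1 := by
    refine Filter.eventually_all.2 fun i => ?_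
    simpa using key (q i) (d i) 1 0 (hq.2 i).2 (h1 i)
  filter_upwards [e1, e2, e3] with ε h1 h2 h3
  exact ⟨fun i j hij => h1 i j hij, fun i => ⟨h2 i, h3 i⟩⟩

/-- First-order optimality of the isotonic fit along tangent directions. -/
theorem IsIsotonicFit.sum_mul_nonpos {n : ℕ} {y q d : Fin n → ℝ} (h : IsIsotonicFit y q)
    (hd : ∀ i j, i ≤ j → q i = q j → d i ≤ d j) (h0 : ∀ i, q i = 0 → 0 ≤ d i)
    (h1 : ∀ i, q i = 1 → d i ≤ 0) :
    ∑ i, (y i - q i) * d i ≤ 0 := by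
  rcases Nat.eq_zero_or_pos n with rfl | hn
  · simp
  have hev : ∀ᶠ ε in nhdsWithin (0 : ℝ) (Ioi 0),
      2 * ∑ i, (y i - q i) * d i ≤ ε * ∑ i, d i ^ 2 := by
    filter_upwards [eventually_add_mul_mem_isotonicSet h.1 hd h0 h1, self_mem_nhdsWithin]
      with ε hε hpos
    have a := h.2 _ hε
    unfold squaredError at a
    have b := le_of_mul_le_mul_left a (by positivity)
    have key : ∑ i, (y i - (q i + ε * d i)) ^ 2 = ∑ i, (y i - q i) ^ 2
        + ε * (ε * ∑ i, d i ^ 2 - 2 * ∑ i, (y i - q i) * d i) := by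
      simp only [Finset.mul_sum, ← Finset.sum_sub_distrib, ← Finset.sum_add_distrib]
      exact Finset.sum_congr rfl fun i _ => by ring
    rw [key] at b
    have c : 0 ≤ ε * ∑ i, d i ^ 2 - 2 * ∑ i, (y i - q i) * d i :=
      nonneg_of_mul_nonneg_right (by linarith) (show 0 < ε from hpos)
    linarith
  have hlim : Filter.Tendsto (fun ε : ℝ => ε * ∑ i, d i ^ 2) (nhdsWithin (0 : ℝ) (Ioi 0))
      (nhds 0) := by
    have : Continuous fun ε : ℝ => ε * ∑ i, d i ^ 2 := by fun_prop
    simpa using (this.tendsto 0).mono_left nhdsWithin_le_nhds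
  have := ge_of_tendsto hlim hev
  linarith

/-- On every upper block the labels sum to at most the fit, even when the cut splits a level block
of the fit. -/
theorem IsIsotonicFit.sum_ge_le {n : ℕ} {y q : Fin n → ℝ} (h : IsIsotonicFit y q)
    (hy : ∀ i, y i ≤ 1) (k : ℕ) :
    ∑ i : Fin n, (if (i : ℕ) < k then 0 else y i - q i) ≤ 0 := by
  -- raise the fit on the upper block; where it equals `1` already, `y i - q i ≤ 0` anyway
  have h1 := h.sum_mul_nonpos (d := fun i => if (i : ℕ) < k then 0 else if q i = 1 then 0 else 1)
    (by
      intro i j hij hq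
      have : (i : ℕ) ≤ j := hij
      rw [hq]
      split_ifs <;> first | omega | norm_num)
    (by intro i _; split_ifs <;> norm_num)
    (by intro i hi; simp [hi])
  refine le_trans (Finset.sum_le_sum fun i _ => ?_) h1
  have := hy i
  split_ifs with h2 h3 <;> simp; all_goals linarith

/-- On every lower block the labels sum to at least the fit. -/
theorem IsIsotonicFit.sum_lt_nonneg {n : ℕ} {y q : Fin n → ℝ} (h : IsIsotonicFit y q)
    (hy : ∀ i, 0 ≤ y i) (k : ℕ) :
    0 ≤ ∑ i : Fin n, (if (i : ℕ) < k then y i - q i else 0) := by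
  have h1 := h.sum_mul_nonpos (d := fun i => if (i : ℕ) < k then if q i = 0 then 0 else -1 else 0)
    (by
      intro i j hij hq
      have : (i : ℕ) ≤ j := hij
      rw [hq]
      split_ifs <;> first | omega | norm_num)
    (by intro i hi; simp [hi])
    (by intro i _; split_ifs <;> norm_num)
  rw [← neg_nonpos, ← Finset.sum_neg_distrib]
  refine le_trans (Finset.sum_le_sum fun i _ => ?_) h1
  have := hy i
  split_ifs with h2 h3 <;> simp; all_goals linarith

theorem thresholdLoss_sub {n : ℕ} (y q : Fin n → ℝ) (k : ℕ) :
    thresholdLoss y k - thresholdLoss q k =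
      ∑ i : Fin n, (if (i : ℕ) < k then 1 else -1) * (y i - q i) := by
  unfold thresholdLoss
  rw [← Finset.sum_sub_distrib]
  refine Finset.sum_congr rfl fun i _ => ?_
  split_ifs <;> ring

theorem sum_min_le_thresholdLoss {n : ℕ} (q : Fin n → ℝ) (k : ℕ) :
    ∑ i, min (q i) (1 - q i) ≤ thresholdLoss q k :=
  Finset.sum_le_sum fun i _ => by
    split_ifs
    · exact min_le_left _ _
    · exact min_le_right _ _

/-- For a sorted sequence, the threshold at which it crosses `1/2` attains the pointwise minimum. -/
theorem exists_thresholdLoss_eq_sum_min {n : ℕ} {q : Fin n → ℝ} (hq : Monotone q) :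
    ∃ k ≤ n, (∀ i : Fin n, (i : ℕ) < k ↔ q i < 1 / 2) ∧
      thresholdLoss q k = ∑ i, min (q i) (1 - q i) := by
  classical
  have hex : ∃ k, ∀ i : Fin n, k ≤ (i : ℕ) → 1 / 2 ≤ q i :=
    ⟨n, fun i hi => absurd i.2 (by omega)⟩
  have hiff : ∀ i : Fin n, (i : ℕ) < Nat.find hex ↔ q i < 1 / 2 := by
    intro i
    constructor
    · intro hi
      by_contra! hge
      exact Nat.find_min hex hi fun j hj => hge.trans (hq hj)
    · intro hi
      by_contra! hge
      exact absurd (Nat.find_spec hex i hge) (not_le.2 hi)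
  refine ⟨Nat.find hex, Nat.find_min' hex fun i hi => absurd i.2 (by omega), hiff, ?_⟩
  refine Finset.sum_congr rfl fun i _ => ?_
  split_ifs with h
  · have := (hiff i).1 h
    rw [min_eq_left (by linarith)]
  · have := mt (hiff i).2 h
    rw [min_eq_right (by linarith)]

/-- The plug-in loss of the isotonic fit is at most the training loss of every threshold
classifier. -/
theorem IsIsotonicFit.sum_min_le {n : ℕ} {y q : Fin n → ℝ} (h : IsIsotonicFit y q)
    (hy : ∀ i, y i ∈ Icc (0 : ℝ) 1) (k : ℕ) :
    ∑ i, min (q i) (1 - q i) ≤ thresholdLoss y k := by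
  refine (sum_min_le_thresholdLoss q k).trans (sub_nonneg.1 ?_)
  have a := h.sum_ge_le (fun i => (hy i).2) k
  have b := h.sum_lt_nonneg (fun i => (hy i).1) k
  rw [thresholdLoss_sub]
  have : ∑ i : Fin n, (if (i : ℕ) < k then (1 : ℝ) else -1) * (y i - q i) =
      ∑ i : Fin n, (if (i : ℕ) < k then y i - q i else 0)
        - ∑ i : Fin n, (if (i : ℕ) < k then 0 else y i - q i) := by
    rw [← Finset.sum_sub_distrib]
    refine Finset.sum_congr rfl fun i _ => ?_
    split_ifs <;> ring
  linarith

/-- The plug-in loss of the isotonic fit is at least the training loss of the threshold classifier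
that cuts where the fit crosses `1/2`. -/
theorem IsIsotonicFit.exists_thresholdLoss_le {n : ℕ} {y q : Fin n → ℝ} (h : IsIsotonicFit y q) :
    ∃ k ≤ n, thresholdLoss y k ≤ ∑ i, min (q i) (1 - q i) := by
  obtain ⟨k, hk, hiff, heq⟩ := exists_thresholdLoss_eq_sum_min h.1.1
  refine ⟨k, hk, ?_⟩
  rw [← heq, ← sub_nonpos, thresholdLoss_sub]
  have h1 := h.sum_mul_nonpos (d := fun i : Fin n => if (i : ℕ) < k then 1 else -1)
    (by
      intro i j _ hq
      simp only [hiff, hq, le_refl])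
    (by
      intro i hi
      have : (i : ℕ) < k := (hiff i).2 (by rw [hi]; norm_num)
      simp [this])
    (by
      intro i hi
      have : ¬ (i : ℕ) < k := fun h => by
        have := (hiff i).1 h
        rw [hi] at this
        norm_num at this
      simp [this])
  simpa only [mul_comm] using h1

/-- Isotonic regression on sorted data is empirical risk minimization over threshold classifiers:
its plug-in loss is close to that of the true posteriors once the empirical and the conditional
risks of all threshold classifiers are close. -/
theorem IsIsotonicFit.abs_sum_min_sub_le {n : ℕ} {y q p : Fin n → ℝ} (h : IsIsotonicFit y q)
    (hy : ∀ i, y i ∈ Icc (0 : ℝ) 1) (hp : Monotone p) {t : ℝ}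
    (ht : ∀ k ≤ n, |thresholdLoss y k - thresholdLoss p k| ≤ t) :
    |∑ i, min (q i) (1 - q i) - ∑ i, min (p i) (1 - p i)| ≤ t := by
  obtain ⟨k, hk, h1⟩ := h.exists_thresholdLoss_le
  obtain ⟨l, hl, -, h2⟩ := exists_thresholdLoss_eq_sum_min hp
  have h3 := h.sum_min_le hy l
  have h4 := sum_min_le_thresholdLoss p k
  have h5 := abs_le.1 (ht k hk)
  have h6 := abs_le.1 (ht l hl)
  rw [abs_le]
  constructor <;> linarith

theorem bayesErrorEstimate_isotonicCalibration {n : ℕ}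
    (ρ : (Fin n → ℝ) → Equiv.Perm (Fin n)) (c y : Fin n → ℝ) :
    bayesErrorEstimate (isotonicCalibration ρ c y) =
      bayesErrorEstimate (isotonicFit (y ∘ ρ c)) := by
  unfold bayesErrorEstimate isotonicCalibration
  congr 1
  exact Equiv.sum_comp (ρ c).symm
    fun j => min (isotonicFit (y ∘ ρ c) j) (1 - isotonicFit (y ∘ ρ c) j)

/-- The sign pattern of the threshold `k`, carried back along the sorting permutation `σ`. -/
def thresholdSign {n : ℕ} (σ : Equiv.Perm (Fin n)) (k : ℕ) (i : Fin n) : ℝ :=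
  if (σ.symm i : ℕ) < k then 1 else -1

/-- The plug-in loss of isotonic calibration deviates from that of the posteriors `p` by no more
than the largest signed sum of the noise `y - p`, when the scores sort the posteriors. -/
theorem abs_bayesErrorEstimate_isotonicCalibration_sub_le {n : ℕ}
    (ρ : (Fin n → ℝ) → Equiv.Perm (Fin n)) {c y p : Fin n → ℝ}
    (hy : ∀ i, y i ∈ Icc (0 : ℝ) 1) (hp : Monotone (p ∘ ρ c)) {t : ℝ}
    (ht : ∀ k ≤ n, |∑ i, thresholdSign (ρ c) k i * (y i - p i)| ≤ t) :
    |bayesErrorEstimate (isotonicCalibration ρ c y) - bayesErrorEstimate p| ≤ 1 / (n : ℝ) * t := by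
  have hperm : bayesErrorEstimate p = bayesErrorEstimate (p ∘ ρ c) := by
    unfold bayesErrorEstimate
    congr 1
    exact (Equiv.sum_comp (ρ c) fun j => min (p j) (1 - p j)).symm
  rw [bayesErrorEstimate_isotonicCalibration, hperm]
  unfold bayesErrorEstimate
  rw [← mul_sub, abs_mul, abs_of_nonneg (by positivity : (0 : ℝ) ≤ 1 / (n : ℝ))]
  refine mul_le_mul_of_nonneg_left ?_ (by positivity)
  refine (isotonicFit_spec (y ∘ ρ c)).abs_sum_min_sub_le (fun i => hy _) hp fun k hk => ?_
  have := ht k hk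
  rw [← Equiv.sum_comp (ρ c)] at this
  simpa [thresholdLoss_sub, thresholdSign] using this

end BayesErr

namespace BayesErr

/-! ### Hard labels as thresholded uniform noise -/

/-- The hard label obtained from a posterior `p` and a noise variable `u`, which is `1` with
probability `p` when `u` is uniform on the unit interval. -/
noncomputable def noisyLabel (p : ℝ) (u : unitInterval) : Fin 2 :=
  if (u : ℝ) < p then 1 else 0

theorem measurable_noisyLabel : Measurable fun w : ℝ × unitInterval => noisyLabel w.1 w.2 := by
  unfold noisyLabel
  refine Measurable.ite (measurableSet_lt ?_ measurable_fst) measurable_const measurable_const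
  exact measurable_subtype_coe.comp measurable_snd

theorem volume_real_setOf_coe_lt {p : ℝ} (hp : p ∈ Icc (0 : ℝ) 1) :
    (volume : Measure unitInterval).real {u | (u : ℝ) < p} = p := by
  have : {u : unitInterval | (u : ℝ) < p} = Iio ⟨p, hp⟩ := rfl
  rw [measureReal_def, this, unitInterval.volume_Iio, ENNReal.toReal_ofReal hp.1]

theorem integral_noisyLabel {p : ℝ} (hp : p ∈ Icc (0 : ℝ) 1) :
    ∫ u : unitInterval, ((noisyLabel p u : ℕ) : ℝ) = p := by
  have hm : MeasurableSet {u : unitInterval | (u : ℝ) < p} :=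
    measurableSet_lt measurable_subtype_coe measurable_const
  have : (fun u : unitInterval => ((noisyLabel p u : ℕ) : ℝ)) =
      {u : unitInterval | (u : ℝ) < p}.indicator 1 := by
    funext u
    unfold noisyLabel
    by_cases h : (u : ℝ) < p <;> simp [h]
  rw [this, integral_indicator_one hm, volume_real_setOf_coe_lt hp]

theorem volume_real_noisyLabel_ne {p : ℝ} (hp : p ∈ Icc (0 : ℝ) 1) (b : Fin 2) :
    (volume : Measure unitInterval).real {u | noisyLabel p u ≠ b} =
      if b = 0 then p else 1 - p := by
  have hm : MeasurableSet {u : unitInterval | (u : ℝ) < p} :=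
    measurableSet_lt measurable_subtype_coe measurable_const
  split_ifs with hb
  · have : {u | noisyLabel p u ≠ b} = {u : unitInterval | (u : ℝ) < p} := by
      ext u
      simp [noisyLabel, hb]
    rw [this, volume_real_setOf_coe_lt hp]
  · have hb1 : b = 1 := by omega
    have : {u | noisyLabel p u ≠ b} = {u : unitInterval | (u : ℝ) < p}ᶜ := by
      ext u
      simp [noisyLabel, hb1]
    rw [this, probReal_compl_eq_one_sub hm, volume_real_setOf_coe_lt hp]

section Posterior

variable {X : Type*} [MeasurableSpace X] {D : Measure (X × Fin 2)} {η : X → ℝ}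

/-- The defining property of the posterior as a disintegration over the marginal law of the
instances. -/
theorem IsPosterior.setIntegral_fst [IsProbabilityMeasure D] (hη : IsPosterior D η) {s : Set X}
    (hs : MeasurableSet s) : ∫ x in s, η x ∂D.fst = D.real (s ×ˢ {1}) := by
  have hle : MeasurableSpace.comap (Prod.fst : X × Fin 2 → X) inferInstance ≤
      (inferInstance : MeasurableSpace (X × Fin 2)) :=
    measurable_fst.comap_le
  have hE : MeasurableSet {z : X × Fin 2 | z.2 = 1} :=
    measurable_snd (measurableSet_singleton 1)
  have hs' : MeasurableSet[MeasurableSpace.comap (Prod.fst : X × Fin 2 → X) inferInstance]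
      (Prod.fst ⁻¹' s : Set (X × Fin 2)) := ⟨s, hs, rfl⟩
  have h1 := setIntegral_condExp (μ := D) hle
    (f := {z : X × Fin 2 | z.2 = 1}.indicator fun _ => (1 : ℝ))
    ((integrable_const (1 : ℝ)).indicator hE) hs'
  rw [Measure.fst, setIntegral_map hs hη.measurable.aestronglyMeasurable
    measurable_fst.aemeasurable]
  refine (setIntegral_congr_ae (measurable_fst hs) (hη.ae_eq.mono fun z hz _ => hz)).trans ?_
  refine h1.trans ?_
  rw [setIntegral_indicator hE, setIntegral_const]
  simp only [smul_eq_mul, mul_one]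
  congr 1

theorem IsPosterior.measurable_noise (hη : IsPosterior D η) :
    Measurable fun w : X × unitInterval => (w.1, noisyLabel (η w.1) w.2) :=
  measurable_fst.prodMk (measurable_noisyLabel.comp
    ((hη.measurable.comp measurable_fst).prodMk measurable_snd))

theorem measureReal_prod_apply {α β : Type*} [MeasurableSpace α] [MeasurableSpace β]
    (μ : Measure α) (ν : Measure β) [IsProbabilityMeasure μ] [IsProbabilityMeasure ν]
    {s : Set (α × β)} (hs : MeasurableSet s) :
    (μ.prod ν).real s = ∫ a, ν.real (Prod.mk a ⁻¹' s) ∂μ := by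
  rw [measureReal_def, Measure.prod_apply hs]
  simp only [measureReal_def]
  rw [integral_toReal (measurable_measure_prodMk_left hs).aemeasurable
    (Filter.Eventually.of_forall fun _ => measure_lt_top _ _)]

/-- Drawing an instance and, independently, a uniform variable that is compared with the posterior
reproduces the joint law of an instance and its label. -/
theorem IsPosterior.measurePreserving_noise [IsProbabilityMeasure D] (hη : IsPosterior D η) :
    MeasurePreserving (fun w : X × unitInterval => (w.1, noisyLabel (η w.1) w.2))
      (D.fst.prod volume) D := by
  have hT := hη.measurable_noise
  refine ⟨hT, ?_⟩
  set T := fun w : X × unitInterval => (w.1, noisyLabel (η w.1) w.2) with hTdef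
  set ν := (D.fst.prod (volume : Measure unitInterval)).map T with hν
  have : IsProbabilityMeasure ν := Measure.isProbabilityMeasure_map hT.aemeasurable
  have h1 : ∀ s : Set X, MeasurableSet s → ν.real (s ×ˢ {1}) = D.real (s ×ˢ {1}) := by
    intro s hs
    rw [← hη.setIntegral_fst hs, hν, map_measureReal_apply hT
      (hs.prod (measurableSet_singleton _)),
      measureReal_prod_apply _ _ (hT (hs.prod (measurableSet_singleton _))),
      ← integral_indicator hs]
    congr 1
    funext x
    by_cases hx : x ∈ s
    · rw [indicator_of_mem hx, ← volume_real_setOf_coe_lt (hη.mem_Icc x)]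
      congr 1
      ext u
      simp [hTdef, hx, noisyLabel]
    · rw [indicator_of_notMem hx]
      have : Prod.mk x ⁻¹' (T ⁻¹' s ×ˢ {1}) = ∅ := by
        ext u
        simp [hTdef, hx]
      rw [this, measureReal_empty]
  have h2 : ∀ s : Set X, MeasurableSet s → ν.real (s ×ˢ univ) = D.real (s ×ˢ univ) := by
    intro s hs
    rw [hν, map_measureReal_apply hT (hs.prod MeasurableSet.univ)]
    have e1 : T ⁻¹' s ×ˢ univ = s ×ˢ univ := by
      ext w
      simp [hTdef]
    rw [e1, measureReal_prod_prod, probReal_univ, mul_one, Measure.fst,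
      map_measureReal_apply measurable_fst hs]
    congr 1
    ext w
    simp
  have h0 : ∀ s : Set X, MeasurableSet s → ν.real (s ×ˢ {0}) = D.real (s ×ˢ {0}) := by
    intro s hs
    have e : (s ×ˢ {0} : Set (X × Fin 2)) = s ×ˢ univ \ s ×ˢ {1} := by
      ext ⟨a, b⟩
      simp only [mem_prod, mem_singleton_iff, mem_sdiff, mem_univ, and_true, not_and]
      constructor
      · rintro ⟨ha, rfl⟩
        simp [ha]
      · rintro ⟨ha, hb⟩
        exact ⟨ha, by have := hb ha; omega⟩
    have hm : MeasurableSet (s ×ˢ {1} : Set (X × Fin 2)) := hs.prod (measurableSet_singleton _)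
    have hsub : (s ×ˢ {1} : Set (X × Fin 2)) ⊆ s ×ˢ univ := prod_mono_right (subset_univ _)
    rw [e, measureReal_sdiff hsub hm, measureReal_sdiff hsub hm, h1 s hs, h2 s hs]
  refine Measure.ext_prod fun {s t} hs ht => ?_
  rw [← measureReal_eq_measureReal_iff]
  have ht' : t = ∅ ∨ t = {0} ∨ t = {1} ∨ t = univ := by
    by_cases a : (0 : Fin 2) ∈ t <;> by_cases b : (1 : Fin 2) ∈ t
    · right; right; right; ext i; fin_cases i <;> simp [a, b]
    · right; left; ext i; fin_cases i <;> simp [a, b]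
    · right; right; left; ext i; fin_cases i <;> simp [a, b]
    · left; ext i; fin_cases i <;> simp [a, b]
  rcases ht' with rfl | rfl | rfl | rfl
  · simp
  · exact h0 s hs
  · exact h1 s hs
  · exact h2 s hs

/-! ### The Bayes error -/

theorem IsPosterior.errorRate_eq [IsProbabilityMeasure D] (hη : IsPosterior D η) {h : X → Fin 2}
    (hh : Measurable h) :
    errorRate D h = ∫ x, (if h x = 0 then η x else 1 - η x) ∂D.fst := by
  have hm : MeasurableSet {z : X × Fin 2 | z.2 ≠ h z.1} :=
    (measurableSet_eq_fun measurable_snd (hh.comp measurable_fst)).compl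
  have hT := hη.measurePreserving_noise
  rw [errorRate, ← hT.measureReal_preimage hm.nullMeasurableSet,
    measureReal_prod_apply _ _ (hT.measurable hm)]
  congr 1
  funext x
  exact volume_real_noisyLabel_ne (hη.mem_Icc x) (h x)

/-- The Bayes classifier predicts `1` where the posterior is at least `1/2`. -/
theorem IsPosterior.bayesError_eq [IsProbabilityMeasure D] (hη : IsPosterior D η) :
    bayesError D = ∫ x, min (η x) (1 - η x) ∂D.fst := by
  classical
  have hmin : Measurable fun x => min (η x) (1 - η x) :=
    hη.measurable.min (measurable_const.sub hη.measurable)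
  apply le_antisymm
  · have hm : MeasurableSet {x | η x < 1 / 2} := measurableSet_lt hη.measurable measurable_const
    have hh : Measurable fun x => if η x < 1 / 2 then (0 : Fin 2) else 1 :=
      Measurable.ite hm measurable_const measurable_const
    have hbdd : BddBelow (range fun h : {h : X → Fin 2 // Measurable h} => errorRate D h.1) :=
      ⟨0, by rintro _ ⟨h, rfl⟩; exact measureReal_nonneg⟩
    refine (ciInf_le hbdd ⟨_, hh⟩).trans (le_of_eq ?_)
    rw [hη.errorRate_eq hh]
    congr 1
    funext x
    by_cases hx : η x < 1 / 2
    · simp only [hx, if_true]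
      rw [min_eq_left (by linarith)]
    · simp only [hx, if_false, one_ne_zero]
      rw [min_eq_right (by linarith)]
  · have : Nonempty {h : X → Fin 2 // Measurable h} := ⟨⟨fun _ => 0, measurable_const⟩⟩
    refine le_ciInf fun ⟨h, hh⟩ => ?_
    rw [hη.errorRate_eq hh]
    have hm : MeasurableSet {x | h x = 0} := hh (measurableSet_singleton 0)
    refine integral_mono
      (Integrable.of_mem_Icc 0 1 hmin.aemeasurable (Filter.Eventually.of_forall fun x => ?_))
      (Integrable.of_mem_Icc 0 1 (Measurable.ite hm hη.measurable
        (measurable_const.sub hη.measurable)).aemeasurable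
        (Filter.Eventually.of_forall fun x => ?_)) fun x => ?_
    · have := hη.mem_Icc x
      exact ⟨le_min this.1 (by linarith [this.2]), (min_le_left _ _).trans this.2⟩
    · have := hη.mem_Icc x
      split_ifs
      · exact this
      · exact ⟨by linarith [this.2], by linarith [this.1]⟩
    · dsimp only
      split_ifs
      · exact min_le_left _ _
      · exact min_le_right _ _

end Posterior

/-! ### Concentration -/

/-- Two-sided Hoeffding inequality for `n` independent variables with ranges of length `1`. -/
theorem measureReal_abs_sum_sub_integral_ge_le {Ω : Type*} [MeasurableSpace Ω] {P : Measure Ω}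
    [IsProbabilityMeasure P] {n : ℕ} {Z : Fin n → Ω → ℝ} {a : Fin n → ℝ}
    (hZ : ∀ i, AEMeasurable (Z i) P) (hb : ∀ i ω, Z i ω ∈ Icc (a i) (a i + 1))
    (hind : iIndepFun Z P) {t : ℝ} (ht : 0 ≤ t) :
    P.real {ω | t ≤ |∑ i, (Z i ω - ∫ ω', Z i ω' ∂P)|} ≤ 2 * Real.exp (-2 * t ^ 2 / n) := by
  have hsub : ∀ i, HasSubgaussianMGF (fun ω => Z i ω - ∫ ω', Z i ω' ∂P)
      ((‖a i + 1 - a i‖₊ / 2) ^ 2) P := fun i =>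
    hasSubgaussianMGF_of_mem_Icc (hZ i) (Filter.Eventually.of_forall (hb i))
  have hc : ∀ m : Fin n → ℝ, (fun i => (‖m i + 1 - m i‖₊ / 2) ^ 2) =
      fun _ => (1 / 4 : NNReal) := by
    intro m
    funext i
    rw [add_sub_cancel_left, nnnorm_one, div_pow]
    norm_num
  have hind' : iIndepFun (fun i ω => Z i ω - ∫ ω', Z i ω' ∂P) P :=
    hind.comp (fun i v => v - ∫ ω', Z i ω' ∂P) fun i => measurable_id.sub_const _
  have hindn : iIndepFun (fun i ω => -(Z i ω - ∫ ω', Z i ω' ∂P)) P :=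
    hind'.comp (fun i v => -v) fun i => measurable_neg
  have hval : -t ^ 2 / (2 * ((∑ i ∈ (Finset.univ : Finset (Fin n)), (1 / 4 : NNReal) : NNReal) : ℝ))
      = -2 * t ^ 2 / n := by
    rw [Finset.sum_const, Finset.card_univ, Fintype.card_fin]
    push_cast
    rcases Nat.eq_zero_or_pos n with rfl | hn
    · simp
    · have : (n : ℝ) ≠ 0 := by positivity
      simp only [nsmul_eq_mul]
      field_simp
      norm_num
  have h1 := HasSubgaussianMGF.measure_sum_ge_le_of_iIndepFun hind' (s := Finset.univ)
    (c := fun _ => 1 / 4) (fun i _ => by have := hsub i; rwa [congrFun (hc a) i] at this) ht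
  have h2 := HasSubgaussianMGF.measure_sum_ge_le_of_iIndepFun hindn (s := Finset.univ)
    (c := fun _ => 1 / 4) (fun i _ => by
      have := (hsub i).neg; rwa [congrFun (hc a) i] at this) ht
  rw [hval] at h1 h2
  have hcover : {ω | t ≤ |∑ i, (Z i ω - ∫ ω', Z i ω' ∂P)|} ⊆
      {ω | t ≤ ∑ i, (Z i ω - ∫ ω', Z i ω' ∂P)} ∪
        {ω | t ≤ ∑ i, -(Z i ω - ∫ ω', Z i ω' ∂P)} := by
    intro ω hω
    rw [mem_union, mem_ofPred_eq, mem_ofPred_eq, Finset.sum_neg_distrib]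
    exact le_abs.1 hω
  calc _ ≤ _ := measureReal_mono hcover
    _ ≤ _ := measureReal_union_le _ _
    _ ≤ _ := by linarith

/-- Hoeffding's inequality for a signed sum of label noises with given posteriors `p`. -/
theorem measureReal_abs_sum_noisyLabel_ge_le {n : ℕ} {p s : Fin n → ℝ}
    (hp : ∀ i, p i ∈ Icc (0 : ℝ) 1) (hs : ∀ i, s i = 1 ∨ s i = -1) {t : ℝ} (ht : 0 ≤ t) :
    (Measure.pi fun _ : Fin n => (volume : Measure unitInterval)).real
      {u | t ≤ |∑ i, s i * (((noisyLabel (p i) (u i) : ℕ) : ℝ) - p i)|} ≤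
        2 * Real.exp (-2 * t ^ 2 / n) := by
  have hm1 : ∀ i, Measurable fun u : unitInterval => s i * ((noisyLabel (p i) u : ℕ) : ℝ) :=
    fun i => measurable_const.mul ((measurable_of_countable fun b : Fin 2 => ((b : ℕ) : ℝ)).comp
      (measurable_noisyLabel.comp (measurable_const.prodMk measurable_id)))
  have hint : ∀ i, ∫ u, s i * ((noisyLabel (p i) (u i) : ℕ) : ℝ)
      ∂(Measure.pi fun _ : Fin n => (volume : Measure unitInterval)) = s i * p i := by
    intro i
    have h := integral_const_mul (μ := (volume : Measure unitInterval)) (s i)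
      fun u => ((noisyLabel (p i) u : ℕ) : ℝ)
    rw [integral_noisyLabel (hp i)] at h
    rw [← h]
    exact ((measurePreserving_eval (fun _ : Fin n => (volume : Measure unitInterval)) i).hasLaw
      |>.integral_comp (hm1 i).aestronglyMeasurable)
  have := measureReal_abs_sum_sub_integral_ge_le
    (P := Measure.pi fun _ : Fin n => (volume : Measure unitInterval))
    (Z := fun i u => s i * ((noisyLabel (p i) (u i) : ℕ) : ℝ)) (a := fun i => min 0 (s i))
    (fun i => ((hm1 i).comp (measurable_pi_apply i)).aemeasurable)
    (fun i u => by
      unfold noisyLabel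
      rcases hs i with h | h <;> rw [h] <;> split_ifs <;> norm_num)
    (iIndepFun_pi fun i => (hm1 i).aemeasurable) ht
  simpa only [hint, ← mul_sub] using this

end BayesErr

namespace BayesErr

theorem thresholdSign_eq_or {n : ℕ} (σ : Equiv.Perm (Fin n)) (k : ℕ) (i : Fin n) :
    thresholdSign σ k i = 1 ∨ thresholdSign σ k i = -1 := by
  unfold thresholdSign
  split_ifs <;> simp

/-- A strictly increasing function on `[0,1]` composed with a measurable function into `[0,1]` is
measurable, whatever its values outside `[0,1]`. -/
theorem measurable_comp_of_strictMonoOn {α : Type*} [MeasurableSpace α] {f : ℝ → ℝ} {η : α → ℝ}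
    (hf : StrictMonoOn f (Icc 0 1)) (hη : Measurable η) (hmem : ∀ x, η x ∈ Icc (0 : ℝ) 1) :
    Measurable fun x => f (η x) := by
  have hmono : Monotone fun t : ℝ => f (projIcc 0 1 zero_le_one t) := fun s t hst =>
    hf.monotoneOn (projIcc 0 1 zero_le_one s).2 (projIcc 0 1 zero_le_one t).2
      (monotone_projIcc _ hst)
  have h := hmono.measurable.comp hη
  have e : ((fun t : ℝ => f (projIcc 0 1 zero_le_one t)) ∘ η) = fun x => f (η x) := by
    funext x
    simp only [Function.comp_apply, projIcc_of_mem zero_le_one (hmem x)]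
  rwa [e] at h

theorem IsSortingRule.measurable_thresholdSign {n : ℕ} {ρ : (Fin n → ℝ) → Equiv.Perm (Fin n)}
    (hρ : IsSortingRule ρ) (k : ℕ) (i : Fin n) :
    Measurable fun c => thresholdSign (ρ c) k i := by
  let _ : MeasurableSpace (Equiv.Perm (Fin n)) := ⊤
  have h : Measurable ρ := measurable_to_countable' fun τ => hρ.measurableSet τ
  exact (measurable_from_top (f := fun σ : Equiv.Perm (Fin n) => thresholdSign σ k i)).comp h

section Sample

variable {X : Type*} [MeasurableSpace X] {D : Measure (X × Fin 2)} {η : X → ℝ} {n : ℕ}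

/-- Instances and label noise of an i.i.d. sample can be drawn independently of each other. -/
theorem IsPosterior.measurePreserving_pi_noise [IsProbabilityMeasure D] (hη : IsPosterior D η)
    (n : ℕ) :
    MeasurePreserving (fun (w : (Fin n → X) × (Fin n → unitInterval)) i =>
        (w.1 i, noisyLabel (η (w.1 i)) (w.2 i)))
      ((Measure.pi fun _ => D.fst).prod (Measure.pi fun _ => volume)) (Measure.pi fun _ => D) :=
  (measurePreserving_pi (fun _ : Fin n => D.fst.prod volume) (fun _ => D)
    fun _ => hη.measurePreserving_noise).comp
    (measurePreserving_arrowProdEquivProdArrow X unitInterval (Fin n) (fun _ => D.fst)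
      fun _ => volume).symm

/-- For each threshold classifier on the sorted sample, the training error is close to its
conditional expectation given the instances. Conditionally on the instances, the sorting permutation
is fixed, since it depends on the scores only, and Hoeffding's inequality applies. -/
theorem IsPosterior.pi_real_abs_sum_thresholdSign_ge_le [IsProbabilityMeasure D]
    (hη : IsPosterior D η) {f : ℝ → ℝ} (hf : StrictMonoOn f (Icc 0 1))
    {ρ : (Fin n → ℝ) → Equiv.Perm (Fin n)} (hρ : IsSortingRule ρ) (k : ℕ) {t : ℝ} (ht : 0 ≤ t) :
    MeasurableSet {z : Fin n → X × Fin 2 | t ≤ |∑ i, thresholdSign (ρ fun j => f (η (z j).1)) k i *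
      ((((z i).2 : ℕ) : ℝ) - η (z i).1)|} ∧
    (Measure.pi fun _ : Fin n => D).real
      {z | t ≤ |∑ i, thresholdSign (ρ fun j => f (η (z j).1)) k i *
        ((((z i).2 : ℕ) : ℝ) - η (z i).1)|} ≤ 2 * Real.exp (-2 * t ^ 2 / n) := by
  have hfη := measurable_comp_of_strictMonoOn hf hη.measurable hη.mem_Icc
  have hc : Measurable fun (z : Fin n → X × Fin 2) (j : Fin n) => f (η (z j).1) :=
    measurable_pi_lambda _ fun j => hfη.comp (measurable_fst.comp (measurable_pi_apply j))
  have hm : MeasurableSet {z : Fin n → X × Fin 2 |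
      t ≤ |∑ i, thresholdSign (ρ fun j => f (η (z j).1)) k i *
        ((((z i).2 : ℕ) : ℝ) - η (z i).1)|} := by
    refine measurableSet_le measurable_const (continuous_abs.measurable.comp ?_)
    refine Finset.measurable_fun_sum _ fun i _ =>
      ((hρ.measurable_thresholdSign k i).comp hc).mul (Measurable.sub ?_ ?_)
    · exact (measurable_of_countable fun b : Fin 2 => ((b : ℕ) : ℝ)).comp
        (measurable_snd.comp (measurable_pi_apply i))
    · exact hη.measurable.comp (measurable_fst.comp (measurable_pi_apply i))
  refine ⟨hm, ?_⟩
  have hT := hη.measurePreserving_pi_noise n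
  rw [← hT.measureReal_preimage hm.nullMeasurableSet, measureReal_prod_apply _ _ (hT.measurable hm)]
  calc _ ≤ ∫ _ : Fin n → X, 2 * Real.exp (-2 * t ^ 2 / n) ∂(Measure.pi fun _ => D.fst) := by
        refine integral_mono_of_nonneg (Filter.Eventually.of_forall fun _ => measureReal_nonneg)
          (integrable_const _) (Filter.Eventually.of_forall fun x => ?_)
        exact measureReal_abs_sum_noisyLabel_ge_le (p := fun i => η (x i))
          (s := fun i => thresholdSign (ρ fun j => f (η (x j))) k i)
          (fun i => hη.mem_Icc _) (fun i => thresholdSign_eq_or _ k i) ht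
    _ = _ := by simp

/-- The empirical mean of `min {η, 1 - η}` concentrates around the Bayes error. -/
theorem IsPosterior.measureReal_abs_sum_min_ge_le [IsProbabilityMeasure D] (hη : IsPosterior D η)
    {Ω : Type*} [MeasurableSpace Ω] {P : Measure Ω} [IsProbabilityMeasure P]
    {z : Fin n → Ω → X × Fin 2} (hlaw : ∀ i, HasLaw (z i) D P) (hind : iIndepFun z P)
    {t : ℝ} (ht : 0 ≤ t) :
    P.real {ω | t ≤ |∑ i, (min (η (z i ω).1) (1 - η (z i ω).1) - bayesError D)|} ≤
      2 * Real.exp (-2 * t ^ 2 / n) := by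
  have hg : Measurable fun x => min (η x) (1 - η x) :=
    hη.measurable.min (measurable_const.sub hη.measurable)
  have hg' : Measurable fun w : X × Fin 2 => min (η w.1) (1 - η w.1) := hg.comp measurable_fst
  have hint : ∀ i, ∫ ω, min (η (z i ω).1) (1 - η (z i ω).1) ∂P = bayesError D := by
    intro i
    rw [hη.bayesError_eq, Measure.fst, integral_map measurable_fst.aemeasurable
      hg.aestronglyMeasurable]
    exact (hlaw i).integral_comp hg'.aestronglyMeasurable
  have := measureReal_abs_sum_sub_integral_ge_le (P := P)
    (Z := fun i ω => min (η (z i ω).1) (1 - η (z i ω).1)) (a := fun _ => 0)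
    (fun i => hg'.comp_aemeasurable (hlaw i).aemeasurable)
    (fun i ω => by
      have := hη.mem_Icc (z i ω).1
      rw [zero_add]
      exact ⟨le_min this.1 (by linarith [this.2]), (min_le_left _ _).trans this.2⟩)
    (hind.comp (fun _ w => min (η w.1) (1 - η w.1)) fun _ => hg') ht
  simpa only [hint] using this

end Sample

/-! ### The deviation of the plug-in estimate from the Bayes error -/

/-- The deviation bound before the choice of `t`: a union bound over the `n + 1` threshold
classifiers and the empirical mean of `min {η, 1 - η}`. -/
theorem IsPosterior.one_sub_le_measureReal {X : Type*} [MeasurableSpace X]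
    {D : Measure (X × Fin 2)} [IsProbabilityMeasure D] {η : X → ℝ} (hη : IsPosterior D η)
    {Ω : Type*} [MeasurableSpace Ω] {P : Measure Ω} [IsProbabilityMeasure P] {n : ℕ} (hn : 0 < n)
    {x : Fin n → Ω → X} {y : Fin n → Ω → Fin 2} (hlaw : ∀ i, HasLaw (fun ω => (x i ω, y i ω)) D P)
    (hind : iIndepFun (fun i ω => (x i ω, y i ω)) P) {ηc : Fin n → Ω → ℝ} {f : ℝ → ℝ}
    (hf : StrictMonoOn f (Icc 0 1)) (hηc : ∀ i, ∀ᵐ ω ∂P, ηc i ω = f (η (x i ω)))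
    {ρ : (Fin n → ℝ) → Equiv.Perm (Fin n)} (hρ : IsSortingRule ρ) {t : ℝ} (ht : 0 ≤ t) :
    1 - (n + 2) * (2 * Real.exp (-2 * t ^ 2 / n)) ≤ P.real {ω |
      |bayesErrorEstimate
          (isotonicCalibration ρ (fun i => ηc i ω) (fun i => ((y i ω : ℕ) : ℝ))) - bayesError D|
        ≤ 2 * (1 / (n : ℝ) * t)} := by
  set G := {ω | |bayesErrorEstimate
    (isotonicCalibration ρ (fun i => ηc i ω) (fun i => ((y i ω : ℕ) : ℝ))) - bayesError D|
      ≤ 2 * (1 / (n : ℝ) * t)} with hG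
  set E := 2 * Real.exp (-2 * t ^ 2 / n) with hE
  let N : Set Ω := {ω | ¬ ∀ i, ηc i ω = f (η (x i ω))}
  let A : ℕ → Set Ω := fun k => {ω | t ≤ |∑ i, thresholdSign (ρ fun j => f (η (x j ω))) k i *
    (((y i ω : ℕ) : ℝ) - η (x i ω))|}
  let B : Set Ω := {ω | t ≤ |∑ i, (min (η (x i ω)) (1 - η (x i ω)) - bayesError D)|}
  have hN : P.real N = 0 := by
    rw [measureReal_def, ae_iff.1 (Filter.eventually_all.2 hηc), ENNReal.toReal_zero]
  have hA : ∀ k, P.real (A k) ≤ E := by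
    intro k
    obtain ⟨hm, hle⟩ := hη.pi_real_abs_sum_thresholdSign_ge_le (n := n) hf hρ k ht
    rw [← (iIndepFun.hasLaw_pi hlaw hind).measureReal_eq hm] at hle
    exact hle
  have hB : P.real B ≤ E := hη.measureReal_abs_sum_min_ge_le hlaw hind ht
  have hcover : (univ : Set Ω) ⊆ G ∪ (N ∪ ((⋃ k ∈ Finset.range (n + 1), A k) ∪ B)) := by
    intro ω _
    by_contra hω
    simp only [mem_union, not_or, mem_iUnion, not_exists] at hω
    obtain ⟨hωG, hωN, hωA, hωB⟩ := hω
    have hc : (fun i => ηc i ω) = fun i => f (η (x i ω)) := funext fun i => not_not.1 hωN i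
    apply hωG
    rw [hG, mem_ofPred_eq, hc]
    have hsorted : Monotone ((fun i => η (x i ω)) ∘ ρ fun i => f (η (x i ω))) := fun i j hij =>
      (hf.le_iff_le (hη.mem_Icc _) (hη.mem_Icc _)).1 (hρ.monotone (fun i => f (η (x i ω))) hij)
    have h1 := abs_bayesErrorEstimate_isotonicCalibration_sub_le ρ
      (c := fun i => f (η (x i ω))) (y := fun i => ((y i ω : ℕ) : ℝ)) (p := fun i => η (x i ω))
      (fun i => ⟨Nat.cast_nonneg _, by
        have : ((y i ω : ℕ)) ≤ 1 := by omega
        exact_mod_cast this⟩)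
      hsorted (t := t)
      fun k hk => (not_le.1 (hωA k (Finset.mem_range.2 (by omega)))).le
    have h2 : |bayesErrorEstimate (fun i => η (x i ω)) - bayesError D| ≤ 1 / (n : ℝ) * t := by
      have hn' : (n : ℝ) ≠ 0 := by positivity
      have : bayesErrorEstimate (fun i => η (x i ω)) - bayesError D =
          1 / (n : ℝ) * ∑ i, (min (η (x i ω)) (1 - η (x i ω)) - bayesError D) := by
        rw [Finset.sum_sub_distrib, Finset.sum_const, Finset.card_univ, Fintype.card_fin,
          nsmul_eq_mul, bayesErrorEstimate, mul_sub]
        field_simp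
      rw [this, abs_mul, abs_of_nonneg (by positivity : (0 : ℝ) ≤ 1 / (n : ℝ))]
      exact mul_le_mul_of_nonneg_left (not_le.1 hωB).le (by positivity)
    calc _ ≤ _ := abs_sub_le _ (bayesErrorEstimate fun i => η (x i ω)) _
      _ ≤ _ := by linarith
  have h1 : P.real (⋃ k ∈ Finset.range (n + 1), A k) ≤ (n + 1) * E := by
    refine (measureReal_biUnion_finset_le _ _).trans ?_
    refine (Finset.sum_le_sum fun k _ => hA k).trans (le_of_eq ?_)
    rw [Finset.sum_const, Finset.card_range, nsmul_eq_mul]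
    push_cast
    ring
  have h2 := (measureReal_mono (μ := P) hcover).trans (measureReal_union_le _ _)
  have h3 := measureReal_union_le (μ := P) N ((⋃ k ∈ Finset.range (n + 1), A k) ∪ B)
  have h4 := measureReal_union_le (μ := P) (⋃ k ∈ Finset.range (n + 1), A k) B
  rw [probReal_univ] at h2
  linarith

end BayesErr

theorem mainTheorem1 :
    ∃ C : ℝ, 0 < C ∧
      ∀ (X : Type*) [MeasurableSpace X]
        -- the joint law of an instance and its label, and the clean soft label
        (D : Measure (X × Fin 2)) [IsProbabilityMeasure D]
        (η : X → ℝ) (_ : BayesErr.IsPosterior D η)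
        -- an i.i.d. sample from this law
        (Ω : Type*) [MeasurableSpace Ω] (P : Measure Ω) [IsProbabilityMeasure P]
        (n : ℕ) (_ : 0 < n)
        (x : Fin n → Ω → X) (y : Fin n → Ω → Fin 2)
        (_ : ∀ i, HasLaw (fun ω => (x i ω, y i ω)) D P)
        (_ : iIndepFun (fun i ω => (x i ω, y i ω)) P)
        -- the corrupted soft labels
        (ηc : Fin n → Ω → ℝ) (f : ℝ → ℝ) (_ : StrictMonoOn f (Icc 0 1))
        (_ : ∀ i, ∀ᵐ ω ∂P, ηc i ω = f (η (x i ω)))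
        (ρ : (Fin n → ℝ) → Equiv.Perm (Fin n)) (_ : BayesErr.IsSortingRule ρ)
        (δ : ℝ) (_ : 0 < δ) (_ : δ < 1),
        1 - δ ≤ P.real {ω |
          |BayesErr.bayesErrorEstimate
              (BayesErr.isotonicCalibration ρ (fun i => ηc i ω) (fun i => ((y i ω : ℕ) : ℝ)))
            - BayesErr.bayesError D|
          ≤ C * (1 / (n : ℝ) ^ (1 / 3 : ℝ) + Real.sqrt (Real.log (1 / δ) / n))} := by
  refine ⟨6, by norm_num, ?_⟩
  intro X _ D _ η hη Ω _ P _ n hn x y hlaw hind ηc f hf hηc ρ hρ δ hδ0 hδ1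
  have hn0 : (0 : ℝ) < n := by exact_mod_cast hn
  have hn1 : (1 : ℝ) ≤ n := by exact_mod_cast hn
  have hlog6 : 0 ≤ Real.log (6 * n) := Real.log_nonneg (by linarith)
  have hlogδ : 0 ≤ Real.log (1 / δ) := Real.log_nonneg (by rw [le_div_iff₀ hδ0]; linarith)
  -- `t` solves `6 * n * exp (-2 * t ^ 2 / n) = δ`, and `2 * (n + 2) ≤ 6 * n`
  set t := Real.sqrt (n * (Real.log (6 * n) + Real.log (1 / δ)) / 2) with ht
  have ht2 : t ^ 2 = n * (Real.log (6 * n) + Real.log (1 / δ)) / 2 :=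
    Real.sq_sqrt (by positivity)
  have hexp : Real.exp (-2 * t ^ 2 / n) = δ / (6 * n) := by
    have : -2 * t ^ 2 / n = Real.log (δ / (6 * n)) := by
      rw [ht2, Real.log_div hδ0.ne' (by positivity), one_div, Real.log_inv]
      field_simp
      ring
    rw [this, Real.exp_log (by positivity)]
  have main := hη.one_sub_le_measureReal hn hlaw hind hf hηc hρ (t := t) (Real.sqrt_nonneg _)
  have hprob : ((n : ℝ) + 2) * (2 * Real.exp (-2 * t ^ 2 / n)) ≤ δ := by
    rw [hexp, mul_div_assoc', mul_div_assoc', div_le_iff₀ (by positivity)]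
    nlinarith
  -- the logarithm from the union bound is absorbed by the rate: `log (6 * n) ≤ 6 * n ^ (1/3)`
  have hroot : Real.log (6 * n) ≤ 6 * (n : ℝ) ^ (1 / 3 : ℝ) := by
    have h1 := Real.log_le_rpow_div (x := 6 * (n : ℝ)) (by positivity)
      (show (0 : ℝ) < 1 / 3 by norm_num)
    rw [Real.mul_rpow (by norm_num) hn0.le] at h1
    have h2 : (6 : ℝ) ^ (1 / 3 : ℝ) ≤ 2 := by
      have h8 : ((2 : ℝ) ^ (3 : ℝ)) ^ (1 / 3 : ℝ) = 2 := by
        rw [← Real.rpow_mul (by norm_num)]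
        norm_num
      calc (6 : ℝ) ^ (1 / 3 : ℝ) ≤ ((2 : ℝ) ^ (3 : ℝ)) ^ (1 / 3 : ℝ) :=
            Real.rpow_le_rpow (by norm_num) (by norm_num) (by norm_num)
        _ = 2 := h8
    have h3 : 0 ≤ (n : ℝ) ^ (1 / 3 : ℝ) := by positivity
    have h4 := mul_le_mul_of_nonneg_right h2 h3
    linarith
  have hbound : 2 * (1 / (n : ℝ) * t) ≤
      6 * (1 / (n : ℝ) ^ (1 / 3 : ℝ) + Real.sqrt (Real.log (1 / δ) / n)) := by
    set r := (n : ℝ) ^ (1 / 3 : ℝ) with hr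
    have hr0 : 0 < r := by positivity
    have hr3 : r ^ 3 = n := by
      rw [hr, ← Real.rpow_natCast, ← Real.rpow_mul hn0.le]
      norm_num
    set s := Real.sqrt (Real.log (1 / δ) / n) with hs
    have hs0 : 0 ≤ s := Real.sqrt_nonneg _
    have hs2 : s ^ 2 = Real.log (1 / δ) / n := Real.sq_sqrt (by positivity)
    refine abs_le_of_sq_le_sq' ?_ (by positivity) |>.2
    have e1 : (2 * (1 / (n : ℝ) * t)) ^ 2 = 2 * (Real.log (6 * n) / n) + 2 * s ^ 2 := by
      rw [hs2, mul_pow, mul_pow, ht2]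
      field_simp
    have e2 : Real.log (6 * n) / n ≤ 6 * (1 / r) ^ 2 := by
      rw [div_le_iff₀ hn0]
      refine hroot.trans (le_of_eq ?_)
      rw [← hr3]
      field_simp
    have e3 : 0 ≤ 1 / r := by positivity
    rw [e1]
    nlinarith [mul_nonneg e3 hs0, sq_nonneg (1 / r), sq_nonneg s]
  calc 1 - δ ≤ _ := by linarith
    _ ≤ _ := main
    _ ≤ _ := measureReal_mono fun ω hω => le_trans hω hbound
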